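/- For a cardinal $\lambda$, say that SCH holds at $\lambda$ if $\lambda^{\mathrm{cf}(\lambda)} = 2^{\mathrm{cf}(\lambda)} + \lambda^+$, and let ESCH be the statement that there is a cardinal $\theta_0$ such that SCH holds at every infinite cardinal $\theta \ge \theta_0$. A category is well accessible if there is a regular cardinal $\mu$ such that it is $\theta$-accessible for every regular cardinal $\theta \ge \mu$; it is large if it is not equivalent to a small category. The presentability rank of an object $M$ is the least regular cardinal $\kappa$ such that $M$ is $\kappa$-presentable; the internal size of $M$ is $\lambda$ if its presentability rank is a successor cardinal $\lambda^+$, and is the presentability rank itself if the latter is not a successor. Assume ESCH, and let $\mathcal{K}$ be a large well accessible category all of whose morphisms are monomorphisms. Then $\mathcal{K}$ is LS-accessible: it is accessible and there is a cardinal $\lambda_0$ such that for every cardinal $\lambda \ge \lambda_0$, $\mathcal{K}$ has an object of presentability rank $\lambda^+$. In particular, $\mathcal{K}$ has an object of internal size $\lambda$ for every sufficiently large cardinal $\lambda$. -/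

import Mathlib

open CategoryTheory

universe w v u

namespace LSAcc

/-- The singular cardinal hypothesis holds at `κ`: `κ ^ cf κ = 2 ^ cf κ + κ⁺`. -/
def SCHAt (κ : Cardinal.{w}) : Prop :=
  κ ^ κ.ord.cof = 2 ^ κ.ord.cof + Order.succ κ

/-- The eventual singular cardinal hypothesis: SCH holds at all high-enough infinite
cardinals (of the universe `w`, which plays the role of the class of all sets). -/
def ESCH : Prop :=
  ∃ θ₀ : Cardinal.{w}, ∀ κ : Cardinal.{w}, Cardinal.aleph0 ≤ κ → θ₀ ≤ κ → SCHAt κ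

section

variable (C : Type u) [Category.{v} C]

/-- `C` is well `μ`-accessible: it is `θ`-accessible for each regular cardinal `θ ≥ μ`. -/
def IsWellCardinalAccessible (μ : Cardinal.{w}) : Prop :=
  ∀ (θ : Cardinal.{w}) [Fact θ.IsRegular], μ ≤ θ → IsCardinalAccessibleCategory C θ

/-- `C` is well accessible: it is well `μ`-accessible for some regular cardinal `μ`. -/
def IsWellAccessible : Prop :=
  ∃ μ : Cardinal.{w}, μ.IsRegular ∧ IsWellCardinalAccessible C μ

/-- `C` is large: it is not equivalent to a small category. For a locally small category
this says that the isomorphism classes of objects do not form a set. -/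
def IsLarge : Prop :=
  ¬ EssentiallySmall.{w} C

variable {C}

/-- `κ` is the presentability rank of `X`: the least regular cardinal `κ`
such that `X` is `κ`-presentable. -/
def HasPresentabilityRank (X : C) (κ : Cardinal.{w}) : Prop :=
  IsLeast {θ : Cardinal.{w} | ∃ _ : Fact θ.IsRegular, IsCardinalPresentable X θ} κ

/-- `κ` is the internal size of `X`: the presentability rank of `X` is `κ⁺`, or it is `κ`
and `κ` is not a successor cardinal. -/
def HasInternalSize (X : C) (κ : Cardinal.{w}) : Prop :=
  HasPresentabilityRank X (Order.succ κ) ∨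
    (HasPresentabilityRank X κ ∧ ∀ θ : Cardinal.{w}, κ ≠ Order.succ θ)

variable (C)

/-- `C` is LS-accessible: it is accessible and has objects of all high-enough successor
presentability ranks. -/
def IsLSAccessible : Prop :=
  IsAccessibleCategory.{w} C ∧
    ∃ κ₀ : Cardinal.{w}, ∀ κ : Cardinal.{w}, κ₀ ≤ κ →
      ∃ X : C, HasPresentabilityRank X (Order.succ κ)

/-- `C` has objects of all high-enough internal sizes. -/
def HasAllLargeInternalSizes : Prop :=
  ∃ κ₀ : Cardinal.{w}, ∀ κ : Cardinal.{w}, κ₀ ≤ κ → ∃ X : C, HasInternalSize X κ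

end

end LSAcc

/-! Fix `μ` witnessing well accessibility and a small generator `P` of `μ`-presentable objects.
Largeness ensures that, for each regular `κ ≥ μ`, some object is not `κ`-presentable. For large `κ`,
the aim is an object that is `κ⁺`-presentable but not `θ`-presentable for any regular `θ ≤ κ`. If
`κ` is regular, the colimit of a `κ`-chain of non-invertible monomorphisms works
(`exists_isCardinalPresentable_succ_of_isRegular`). If `κ` is singular, morphisms from `P` are
counted. Some `κ⁺`-presentable object receives at least `κ` of them
(`exists_isCardinalPresentable_succ_not_hasCardinalLT`), while a `χ⁺`-presentable one with `χ ^ μ =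
χ` receives at most `χ` (`exists_hasCardinalLT_sigma_hom`). ESCH enters only here: by
`power_le_succ_of_schAt`, suitable `χ` lie cofinally below `κ`. -/

namespace LSAcc

/-! ### Cardinal powers under SCH. -/

section CardinalArithmetic

open Cardinal Set

theorem mk_Iio_toType_lt {κ : Cardinal.{w}} (a : κ.ord.ToType) : #(Iio a) < κ := by
  simpa using mk_Iio_lt a (by simp)

/-- If `μ < cf κ`, every function from `μ` to `κ` is bounded, so `κ ^ μ` is controlled by
the powers `α ^ μ` for `α < κ`. -/
theorem power_le_self_of_lt_cof {κ μ : Cardinal.{w}} (hκ : ℵ₀ ≤ κ) (hμ : μ < κ.ord.cof)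
    (h : ∀ α < κ, α ^ μ ≤ κ) : κ ^ μ ≤ κ := by
  have hbdd (f : μ.out → κ.ord.ToType) : ∃ a, ∀ i, f i < a := by
    have hr : #(range f) < Order.cof κ.ord.ToType := by
      rw [Ordinal.cof_toType]
      exact mk_range_le.trans_lt (by simpa using hμ)
    have hn : ¬ IsCofinal (range f) := fun hc ↦ (Order.cof_le hc).not_gt hr
    obtain ⟨a, ha⟩ := not_isCofinal_iff.1 hn
    exact ⟨a, fun i ↦ ha _ ⟨i, rfl⟩⟩
  let g : (Σ a : κ.ord.ToType, (μ.out → Iio a)) → (μ.out → κ.ord.ToType) :=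
    fun x i ↦ (x.2 i).1
  have hg : Function.Surjective g := fun f ↦ by
    obtain ⟨a, ha⟩ := hbdd f
    exact ⟨⟨a, fun i ↦ ⟨f i, ha i⟩⟩, rfl⟩
  calc κ ^ μ = #(μ.out → κ.ord.ToType) := by simp
    _ ≤ #(Σ a : κ.ord.ToType, (μ.out → Iio a)) := mk_le_of_surjective hg
    _ = Cardinal.sum fun a : κ.ord.ToType ↦ #(Iio a) ^ μ := by simp [mk_sigma]
    _ ≤ Cardinal.sum fun _ : κ.ord.ToType ↦ κ :=
        sum_le_sum _ _ fun a ↦ h _ (mk_Iio_toType_lt a)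
    _ = κ := by simp [mul_eq_self hκ]

/-- If `α ^ μ ≤ κ` for all `α < κ`, then `κ ^ μ ≤ κ ^ cf κ`. -/
theorem power_le_power_cof {κ μ : Cardinal.{w}} (hκ : ℵ₀ ≤ κ)
    (h : ∀ α < κ, α ^ μ ≤ κ) : κ ^ μ ≤ κ ^ κ.ord.cof := by
  classical
  obtain ⟨s, hs, hs'⟩ := Order.exists_cof_eq κ.ord.ToType
  have : NoMaxOrder κ.ord.ToType := noMaxOrder hκ
  -- Code `f` by its truncations at the points of a cofinal set, `none` marking values that are too
  -- big. Each value is visible in some truncation, so the code is injective.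
  let g (f : μ.out → κ.ord.ToType) (b : s) (i : μ.out) : Option (Iic b.1) :=
    if hb : f i ≤ b.1 then some ⟨f i, hb⟩ else none
  have hg : Function.Injective g := fun f₁ f₂ hf ↦ by
    funext i
    obtain ⟨b, hb, hib⟩ := hs (f₁ i)
    have := congr_fun (congr_fun hf ⟨b, hb⟩) i
    by_cases h₂ : f₂ i ≤ b
    · simp only [g, hib, h₂, dite_true, Option.some.injEq] at this
      exact congrArg Subtype.val this
    · simp [g, hib, h₂] at this
  have hlt (b : κ.ord.ToType) : #(Option (Iic b)) < κ := by
    obtain ⟨c, hc⟩ := exists_gt b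
    rw [mk_option]
    refine add_lt_of_lt hκ ?_ (one_lt_aleph0.trans_le hκ)
    exact (mk_le_mk_of_subset (fun x hx ↦ lt_of_le_of_lt hx hc)).trans_lt (mk_Iio_toType_lt c)
  calc κ ^ μ = #(μ.out → κ.ord.ToType) := by simp
    _ ≤ #(∀ b : s, (μ.out → Option (Iic b.1))) := mk_le_of_injective hg
    _ = Cardinal.prod fun b : s ↦ #(Option (Iic b.1)) ^ μ := by
        rw [mk_pi]
        simp only [← power_def, mk_out]
    _ ≤ Cardinal.prod fun _ : s ↦ κ := prod_le_prod _ _ fun b ↦ h _ (hlt b)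
    _ = κ ^ κ.ord.cof := by rw [prod_const', hs', Ordinal.cof_toType]

/-- If SCH holds above `θ₀`, then `κ ^ μ ≤ κ⁺` for every infinite `μ` and `κ ≥ 2 ^ max θ₀ μ`. -/
theorem power_le_succ_of_schAt {θ₀ μ : Cardinal.{w}} (hμ : ℵ₀ ≤ μ)
    (hsch : ∀ κ : Cardinal.{w}, ℵ₀ ≤ κ → θ₀ ≤ κ → SCHAt κ)
    (κ : Cardinal.{w}) (hκ : 2 ^ max θ₀ μ ≤ κ) : κ ^ μ ≤ Order.succ κ := by
  induction κ using WellFoundedLT.induction with | ind κ ih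
  have hc : ℵ₀ ≤ max θ₀ μ := hμ.trans (le_max_right _ _)
  have hcκ : max θ₀ μ ≤ κ := (cantor _).le.trans hκ
  have hκ₀ : ℵ₀ ≤ κ := hc.trans hcκ
  have hlt (α) (hα : α < κ) : α ^ μ ≤ κ := by
    by_cases h : 2 ^ max θ₀ μ ≤ α
    · exact (ih α hα h).trans (Order.succ_le_of_lt hα)
    · calc α ^ μ ≤ (2 ^ max θ₀ μ) ^ μ := power_le_power_right (not_le.1 h).le
        _ = 2 ^ max θ₀ μ := by
          rw [← power_mul, mul_eq_left hc (le_max_right _ _) (aleph0_pos.trans_le hμ).ne']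
        _ ≤ κ := hκ
  -- SCH at `κ` is needed only when `cf κ ≤ μ`; then `2 ^ cf κ ≤ κ` by the choice of threshold.
  by_cases hcof : μ < κ.ord.cof
  · exact (power_le_self_of_lt_cof hκ₀ hcof hlt).trans (Order.le_succ κ)
  · have h2 : (2 : Cardinal.{w}) ^ κ.ord.cof ≤ Order.succ κ :=
      ((power_le_power_left two_ne_zero ((not_lt.1 hcof).trans (le_max_right _ _))).trans hκ).trans
        (Order.le_succ κ)
    calc κ ^ μ ≤ κ ^ κ.ord.cof := power_le_power_cof hκ₀ hlt
      _ = 2 ^ κ.ord.cof + Order.succ κ := hsch κ hκ₀ ((le_max_left _ _).trans hcκ)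
      _ ≤ Order.succ κ := by rw [add_eq_right (hκ₀.trans (Order.le_succ κ)) h2]

end CardinalArithmetic

/-! ### Chains of monomorphisms: the regular case. -/

open Limits

section

variable {C : Type u} [Category.{v} C]

/-- A monomorphism through which all the legs of a colimit cocone factor is an isomorphism. -/
theorem isIso_of_forall_factors {J : Type*} [Category* J] {X Y : C}
    (p : ColimitPresentation J X) (f : Y ⟶ X) [Mono f]
    (h : ∀ j, ∃ g : p.diag.obj j ⟶ Y, g ≫ f = p.ι.app j) : IsIso f := by
  choose g hg using h
  let s : Cocone p.diag :=
    { pt := Y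
      ι :=
        { app := g
          naturality := fun i j a ↦ by
            rw [← cancel_mono f]
            simp [hg] } }
  have hs : p.isColimit.desc s ≫ f = 𝟙 X := p.isColimit.hom_ext fun j ↦ by
    have := p.isColimit.fac s j
    dsimp at this ⊢
    rw [reassoc_of% this, Category.comp_id]
    exact hg j
  have : IsSplitEpi f := ⟨⟨⟨_, hs⟩⟩⟩
  exact isIso_of_mono_of_isSplitEpi f

/-- If `κ` is regular and `C` is a `κ`-accessible category of monomorphisms with an object that
is not `κ`-presentable, then there is a `κ⁺`-presentable object that is not `κ`-presentable:
the colimit of a strictly increasing `κ`-chain of `κ`-presentable objects. -/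
theorem exists_isCardinalPresentable_succ_of_isRegular
    (hmono : ∀ {X Y : C} (f : X ⟶ Y), Mono f) (κ : Cardinal.{w}) [hκ : Fact κ.IsRegular]
    [Fact (Order.succ κ).IsRegular] [IsCardinalAccessibleCategory C κ]
    {M : C} (hM : ¬ IsCardinalPresentable M κ) :
    ∃ N : C, IsCardinalPresentable N (Order.succ κ) ∧ ¬ IsCardinalPresentable N κ := by
  obtain ⟨P, _, hP⟩ := HasCardinalFilteredGenerator.exists_generator C κ
  obtain ⟨J, _, _, ⟨p₀⟩⟩ := hP.exists_colimitsOfShape M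
  obtain ⟨I, _, _, G, _⟩ := IsCardinalFiltered.exists_cardinal_directed J κ
  let p := p₀.reindex G
  have hp (i : I) : IsCardinalPresentable (p.diag.obj i) κ :=
    hP.le_isCardinalPresentable _ (p.prop_diag_obj i)
  -- If all maps out of stage `i` were invertible, every leg would factor through the leg at `i`,
  -- making `M` isomorphic to a `κ`-presentable object.
  have hstep (i : I) : ∃ (j : I) (a : i ⟶ j), ¬ IsIso (p.diag.map a) := by
    by_contra! hi
    refine hM ?_
    have := isFiltered_of_isCardinalFiltered I κ
    have := hmono (p.ι.app i)
    have : IsIso (p.ι.app i) := isIso_of_forall_factors p.toColimitPresentation _ fun k ↦ by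
      have := hi _ (IsFiltered.leftToMax i k)
      refine ⟨p.diag.map (IsFiltered.rightToMax i k) ≫
        inv (p.diag.map (IsFiltered.leftToMax i k)), ?_⟩
      rw [Category.assoc, ← p.w (IsFiltered.leftToMax i k), IsIso.inv_hom_id_assoc]
      exact p.w (IsFiltered.rightToMax i k)
    exact isCardinalPresentable_of_iso (asIso (p.ι.app i)) κ
  choose next toNext hnext using hstep
  let T := κ.ord.ToType
  have hT (t : T) : HasCardinalLT (Set.Iio t) κ := by
    rw [hasCardinalLT_iff_cardinal_mk_lt]
    exact mk_Iio_toType_lt t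
  let bound (t : T) (x : Set.Iio t → I) : I := IsCardinalFiltered.max x (hT t)
  -- Bound all earlier stages, then make a non-invertible step; successor and limit stages are
  -- treated alike.
  let c : T → I := (wellFounded_lt (α := T)).fix fun t rec ↦
    next (bound t fun s ↦ rec s.1 s.2)
  have hc (t : T) : c t = next (bound t fun s ↦ c s.1) := WellFounded.fix_eq _ _ _
  let b (t : T) : I := bound t fun s ↦ c s.1
  have hcb {s t : T} (hst : s < t) : c s ≤ b t :=
    leOfHom (IsCardinalFiltered.toMax (fun s : Set.Iio t ↦ c s.1) (hT t) ⟨s, hst⟩)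
  have hbc (t : T) : ∃ a : b t ⟶ c t, ¬ IsIso (p.diag.map a) := by
    rw [hc t]
    exact ⟨_, hnext (b t)⟩
  choose toC htoC using hbc
  have hcmono : Monotone c := fun s t hst ↦ by
    obtain rfl | hst := hst.eq_or_lt
    · rfl
    · exact (hcb hst).trans (leOfHom (toC t))
  have := HasCardinalFilteredColimits.hasColimitsOfShape (κ := κ) C T
  let F : T ⥤ C := hcmono.functor ⋙ p.diag
  have hF (t : T) : IsCardinalPresentable (F.obj t) (Order.succ κ) :=
    have := hp (c t)
    isCardinalPresentable_of_le (κ := κ) (p.diag.obj (c t)) (Order.le_succ κ)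
  refine ⟨colimit F, ?_, fun _ ↦ ?_⟩
  · refine isCardinalPresentable_of_isColimit _ (colimit.isColimit F) (Order.succ κ) ?_
    have hT' : HasCardinalLT T (Order.succ κ) := by
      simp [hasCardinalLT_iff_cardinal_mk_lt, T]
    refine (hasCardinalLT_prod (hκ.out.aleph0_le.trans (Order.le_succ κ)) hT' hT').of_injective
      (fun a : Arrow T ↦ (a.left, a.right)) ?_
    rintro ⟨a₁, a₂, a⟩ ⟨b₁, b₂, b⟩ hab
    obtain ⟨rfl, rfl⟩ := Prod.mk.inj hab
    obtain rfl : a = b := Subsingleton.elim _ _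
    rfl
  -- If the identity factored through stage `s`, the legs from `b t` and `c t` would be split
  -- epimorphisms for `t > s`, hence isomorphisms, and so would the step between them.
  · obtain ⟨s, r, hr⟩ := IsCardinalPresentable.exists_hom_of_isColimit κ
      (colimit.isColimit F) (𝟙 (colimit F))
    have : NoMaxOrder T := Cardinal.noMaxOrder hκ.out.aleph0_le
    obtain ⟨t, hst⟩ := exists_gt s
    obtain ⟨f, g, hfg, hg⟩ : ∃ (f : F.obj s ⟶ p.diag.obj (b t)) (g : p.diag.obj (b t) ⟶ F.obj t),
        F.map (homOfLE hst.le) = f ≫ g ∧ ¬ IsIso g :=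
      ⟨p.diag.map (homOfLE (hcb hst)), p.diag.map (toC t), p.diag.map_comp _ _, htoC t⟩
    have hr' : r ≫ f ≫ g ≫ colimit.ι F t = 𝟙 (colimit F) := by
      rw [← hr, ← reassoc_of% hfg, colimit.w]
      rfl
    have : IsSplitEpi (colimit.ι F t) := ⟨⟨⟨r ≫ f ≫ g, by simpa using hr'⟩⟩⟩
    have : IsSplitEpi (g ≫ colimit.ι F t) := ⟨⟨⟨r ≫ f, by simpa using hr'⟩⟩⟩
    have := hmono (colimit.ι F t)
    have := hmono (g ≫ colimit.ι F t)
    have := isIso_of_mono_of_isSplitEpi (colimit.ι F t)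
    have := isIso_of_mono_of_isSplitEpi (g ≫ colimit.ι F t)
    exact hg (IsIso.of_isIso_comp_right g (colimit.ι F t))

/-! ### Decomposing a colimit along directed subsets. -/

section SubsetColimits

variable {I : Type w} [PartialOrder I] (D : I ⥤ C)

/-- A family of morphisms `D.obj i ⟶ K` for `i` in a subset `S` of the index poset is a colimit
cocone over the restriction of `D` to `S`. -/
structure IsSubsetColimit (S : Set I) {K : C} (leg : ∀ i ∈ S, D.obj i ⟶ K) : Prop where
  w {i j : I} (a : i ⟶ j) (hi : i ∈ S) (hj : j ∈ S) : D.map a ≫ leg j hj = leg i hi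
  exists_desc {X : C} (f : ∀ i ∈ S, D.obj i ⟶ X)
    (hf : ∀ (i j : I) (a : i ⟶ j) (hi : i ∈ S) (hj : j ∈ S), D.map a ≫ f j hj = f i hi) :
    ∃ m : K ⟶ X, ∀ i hi, leg i hi ≫ m = f i hi
  hom_ext {X : C} {f g : K ⟶ X} (h : ∀ i hi, leg i hi ≫ f = leg i hi ≫ g) : f = g

/-- Colimits of the restriction of `D` to `μ`-directed subsets, and factorizations of morphisms
from `μ`-presentable objects to them. -/
theorem exists_isSubsetColimit (μ : Cardinal.{w}) [Fact μ.IsRegular]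
    [HasCardinalFilteredColimits C μ] (S : Set I) [IsCardinalFiltered S μ] :
    ∃ (K : C) (leg : ∀ i ∈ S, D.obj i ⟶ K), IsSubsetColimit D S leg ∧
      ∀ (A : C) [IsCardinalPresentable A μ] (f : A ⟶ K),
        ∃ (i : I) (hi : i ∈ S) (g : A ⟶ D.obj i), g ≫ leg i hi = f := by
  have := HasCardinalFilteredColimits.hasColimitsOfShape (κ := μ) C S
  let E : S ⥤ C := (Subtype.mono_coe (· ∈ S)).functor ⋙ D
  refine ⟨colimit E, fun i hi ↦ colimit.ι E ⟨i, hi⟩, ⟨?_, ?_, ?_⟩, ?_⟩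
  · intro i j a hi hj
    exact colimit.w E (homOfLE (leOfHom a) : (⟨i, hi⟩ : S) ⟶ ⟨j, hj⟩)
  · intro X f hf
    let s : Cocone E :=
      { pt := X
        ι :=
          { app := fun i ↦ f i.1 i.2
            naturality := fun i j a ↦
              (hf i.1 j.1 (homOfLE (leOfHom a)) i.2 j.2).trans (Category.comp_id _).symm } }
    exact ⟨colimit.desc E s, fun i hi ↦ colimit.ι_desc s ⟨i, hi⟩⟩
  · intro X f g h
    exact colimit.hom_ext fun i ↦ h i.1 i.2
  · intro A _ f
    obtain ⟨i, g, hg⟩ := IsCardinalPresentable.exists_hom_of_isColimit μ (colimit.isColimit E) f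
    exact ⟨i.1, i.2, g, hg⟩

/-- If the subsets satisfying `Q` are `μ`-directed, they form a `κ`-directed family, and they
cover the index poset of a colimit `N`, then the identity of any `κ`-presentable `N` factors
through the colimit over one of these subsets. In particular any morphism from a `μ`-presentable
object to `N` factors through a term of the diagram indexed by this subset. -/
theorem exists_subset_forall_factors {N : C} (p : ColimitPresentation I N)
    (μ κ : Cardinal.{w}) [Fact μ.IsRegular] [Fact κ.IsRegular]
    [HasCardinalFilteredColimits C μ] [IsCardinalPresentable N κ]
    (Q : Set I → Prop) (hQ : ∀ S, Q S → IsCardinalFiltered S μ)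
    [IsCardinalFiltered (Subtype Q) κ] (hcover : ∀ i : I, ∃ S : Subtype Q, i ∈ S.1) :
    ∃ S : Subtype Q, ∀ (A : C) [IsCardinalPresentable A μ] (f : A ⟶ N),
      ∃ i ∈ S.1, ∃ g : A ⟶ p.diag.obj i, g ≫ p.ι.app i = f := by
  have := isFiltered_of_isCardinalFiltered (Subtype Q) κ
  obtain ⟨F, leg, hleg, hfac, hmap⟩ : ∃ (F : Subtype Q ⥤ C)
      (leg : ∀ S : Subtype Q, ∀ i ∈ S.1, p.diag.obj i ⟶ F.obj S),
      (∀ S : Subtype Q, IsSubsetColimit p.diag S.1 (leg S)) ∧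
      (∀ (S : Subtype Q) (A : C) [IsCardinalPresentable A μ] (f : A ⟶ F.obj S),
        ∃ (i : I) (hi : i ∈ S.1) (g : A ⟶ p.diag.obj i), g ≫ leg S i hi = f) ∧
      ∀ (S T : Subtype Q) (h : S ⟶ T) (i : I) (hi : i ∈ S.1),
        leg S i hi ≫ F.map h = leg T i (leOfHom h hi) := by
    choose K leg hleg hfac using fun S : Subtype Q ↦
      have := hQ S.1 S.2
      exists_isSubsetColimit p.diag μ S.1
    choose m hm using fun (S T : Subtype Q) (h : S ⟶ T) ↦ (hleg S).exists_desc
      (fun i hi ↦ leg T i (leOfHom h hi)) fun i j a _ _ ↦ (hleg T).w a _ _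
    exact ⟨
      { obj := K
        map := fun {S T} h ↦ m S T h
        map_id := fun S ↦ (hleg S).hom_ext fun i hi ↦ by rw [hm, Category.comp_id]
        map_comp := fun {S T U} f g ↦ (hleg S).hom_ext fun i hi ↦ by
          rw [hm, ← Category.assoc, hm, hm] }, leg, hleg, hfac, hm⟩
  choose q hq using fun S : Subtype Q ↦ (hleg S).exists_desc (fun i _ ↦ p.ι.app i)
    fun i j a _ _ ↦ p.w a
  have hqw {S T : Subtype Q} (h : S ⟶ T) : F.map h ≫ q T = q S :=
    (hleg S).hom_ext fun i hi ↦ by rw [← Category.assoc, hmap, hq, hq]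
  let c : Cocone F :=
    { pt := N
      ι := { app := q, naturality := fun S T h ↦ (hqw h).trans (Category.comp_id _).symm } }
  choose S hS using hcover
  -- Directedness makes the induced leg at `i` independent of the chosen subset containing `i`, so
  -- `N` is the colimit of the subset colimits.
  have key (s : Cocone F) (i : I) (T : Subtype Q) (hi : i ∈ T.1) :
      leg (S i) i (hS i) ≫ s.ι.app (S i) = leg T i hi ≫ s.ι.app T := by
    rw [← s.w (IsFiltered.leftToMax (S i) T), ← s.w (IsFiltered.rightToMax (S i) T),
      ← Category.assoc, ← Category.assoc, hmap, hmap]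
  have hdw (s : Cocone F) {i j : I} (a : i ⟶ j) :
      p.diag.map a ≫ leg (S j) j (hS j) ≫ s.ι.app (S j) = leg (S i) i (hS i) ≫ s.ι.app (S i) := by
    let T := IsFiltered.max (S i) (S j)
    have hi : i ∈ T.1 := leOfHom (IsFiltered.leftToMax (S i) (S j)) (hS i)
    have hj : j ∈ T.1 := leOfHom (IsFiltered.rightToMax (S i) (S j)) (hS j)
    rw [key s i T hi, key s j T hj, ← Category.assoc, (hleg T).w a hi hj]
  let d (s : Cocone F) : Cocone p.diag :=
    { pt := s.pt
      ι :=
        { app := fun i ↦ leg (S i) i (hS i) ≫ s.ι.app (S i)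
          naturality := fun i j a ↦ (hdw s a).trans (Category.comp_id _).symm } }
  have hd (s : Cocone F) (i : I) :
      p.ι.app i ≫ p.isColimit.desc (d s) = leg (S i) i (hS i) ≫ s.ι.app (S i) :=
    p.isColimit.fac (d s) i
  have hc : IsColimit c :=
    { desc := fun s ↦ p.isColimit.desc (d s)
      fac := fun s T ↦ (hleg T).hom_ext fun i hi ↦ by
        rw [← key s i T hi, ← hd s i]
        exact (Category.assoc _ _ _).symm.trans (congrArg (· ≫ _) (hq T i hi))
      uniq := fun s m hm ↦ p.isColimit.hom_ext fun i ↦ by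
        refine Eq.trans ?_ (hd s i).symm
        rw [← hm (S i)]
        exact (congrArg (· ≫ m) (hq (S i) i (hS i)).symm).trans (Category.assoc _ _ _) }
  obtain ⟨T, r, hr⟩ : ∃ (T : Subtype Q) (r : N ⟶ F.obj T), r ≫ q T = 𝟙 N :=
    IsCardinalPresentable.exists_hom_of_isColimit κ hc (𝟙 N)
  refine ⟨T, fun A _ f ↦ ?_⟩
  obtain ⟨i, hi, g, hg⟩ := hfac T A (f ≫ r)
  exact ⟨i, hi, g, by rw [← hq T i hi, ← Category.assoc, hg, Category.assoc, hr,
    Category.comp_id]⟩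

end SubsetColimits

/-! ### Counting morphisms from the generator. -/

open Cardinal

/-- If `χ ^ μ = χ`, then in a `μ`-directed poset every subset of cardinality at most `χ` is
contained in a `μ`-directed subset of cardinality at most `χ`. -/
theorem exists_isCardinalFiltered_superset {μ χ : Cardinal.{w}} [hμ : Fact μ.IsRegular]
    [Fact (Order.succ χ).IsRegular] (hμχ : μ ≤ χ) (hχ : χ ^ μ = χ)
    {I : Type w} [PartialOrder I] [IsCardinalFiltered I μ] (A : Set I)
    (hA : HasCardinalLT A (Order.succ χ)) :
    ∃ B : Set I, A ⊆ B ∧ IsCardinalFiltered B μ ∧ HasCardinalLT B (Order.succ χ) := by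
  refine SharplyLT.exists_isCardinalFiltered_set_of_exists_cofinal
    (Order.lt_succ_of_le hμχ) (fun X hX ↦ ⟨Set.univ, ?_, IsCofinal.univ⟩) A hA
  rw [hasCardinalLT_iff_cardinal_mk_lt, Order.lt_succ_iff] at hX ⊢
  rw [mk_univ]
  -- All small subsets of `X` serve as the cofinal family: there are at most `χ ^ μ = χ` of them.
  refine (mk_subtype_le_of_subset (q := fun t : Set X ↦ #t ≤ μ) fun t ht ↦ ?_).trans
    ((mk_bounded_set_le X μ).trans ?_)
  · exact ((hasCardinalLT_iff_cardinal_mk_lt _ _).1 ht).le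
  · exact (power_le_power_right (max_le hX (hμ.out.aleph0_le.trans hμχ))).trans hχ.le

/-- Let `P` be a small generator of `μ`-presentable objects in a `μ`-accessible category.
If `χ` is large enough and `χ ^ μ = χ`, then a `χ⁺`-presentable object receives at most `χ`
morphisms from objects in `P`. -/
theorem exists_hasCardinalLT_sigma_hom (μ : Cardinal.{w}) [hμ : Fact μ.IsRegular]
    [IsCardinalAccessibleCategory C μ] (P : ObjectProperty C) [ObjectProperty.Small.{w} P]
    (hP : P.IsCardinalFilteredGenerator μ) :
    ∃ ν : Cardinal.{w}, ∀ (χ : Cardinal.{w}) [Fact (Order.succ χ).IsRegular],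
      ν ≤ χ → μ ≤ χ → χ ^ μ = χ → ∀ N : C, IsCardinalPresentable N (Order.succ χ) →
        HasCardinalLT (Σ A : Subtype P, (A.1 ⟶ N)) (Order.succ χ) := by
  -- `ν` exceeds the number of morphisms between objects of `P`, so each of the at most `χ` diagram
  -- terms used below contributes fewer than `ν` morphisms.
  obtain ⟨ν, -, hν⟩ := HasCardinalLT.exists_regular_cardinal.{w}
    (Σ B : Subtype P, Σ A : Subtype P, (A.1 ⟶ B.1))
  refine ⟨ν, fun χ hreg hνχ hμχ hχ N hN ↦ ?_⟩
  have hω : ℵ₀ ≤ Order.succ χ := hreg.out.aleph0_le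
  obtain ⟨J, _, _, ⟨p₀⟩⟩ := hP.exists_colimitsOfShape N
  obtain ⟨I, _, _, G, _⟩ := IsCardinalFiltered.exists_cardinal_directed J μ
  let p := p₀.reindex G
  let Q (S : Set I) : Prop := IsCardinalFiltered S μ ∧ HasCardinalLT S (Order.succ χ)
  have hQ (A : Set I) (hA : HasCardinalLT A (Order.succ χ)) : ∃ S : Subtype Q, A ⊆ S.1 := by
    obtain ⟨B, hAB, hB⟩ := exists_isCardinalFiltered_superset hμχ hχ A hA
    exact ⟨⟨B, hB⟩, hAB⟩
  have : IsCardinalFiltered (Subtype Q) (Order.succ χ) :=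
    isCardinalFiltered_preorder _ _ fun K s hK ↦ by
      obtain ⟨S, hS⟩ := hQ (⋃ k, (s k).1) (hasCardinalLT_iUnion _
        ((hasCardinalLT_iff_cardinal_mk_lt _ _).2 hK) fun k ↦ (s k).2.2)
      exact ⟨S, fun k ↦ (Set.subset_iUnion _ k).trans hS⟩
  obtain ⟨S, hS⟩ := exists_subset_forall_factors p.toColimitPresentation μ (Order.succ χ) Q
    (fun _ h ↦ h.1) fun i ↦ by
      obtain ⟨S, hS⟩ := hQ {i} (hasCardinalLT_of_finite _ _ hω)
      exact ⟨S, hS rfl⟩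
  refine (hasCardinalLT_sigma (fun i : S.1 ↦ Σ A : Subtype P, (A.1 ⟶ p.diag.obj i.1))
    (Order.succ χ) S.2.2 fun i ↦ ?_).of_surjective
      (fun x ↦ ⟨x.2.1, x.2.2 ≫ p.ι.app x.1.1⟩) ?_
  · exact (hν.of_le (hνχ.trans (Order.le_succ χ))).of_injective
      (fun x ↦ ⟨⟨_, p.prop_diag_obj i.1⟩, x⟩) fun x y hxy ↦ by simpa using hxy
  · rintro ⟨A, f⟩
    have : IsCardinalPresentable A.1 μ := hP.le_isCardinalPresentable _ A.2
    obtain ⟨i, hi, g, rfl⟩ := hS A.1 f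
    exact ⟨⟨⟨i, hi⟩, A, g⟩, rfl⟩

/-- A family of morphisms, indexed by a type of cardinality `< κ`, from `κ`-presentable objects
to a `κ`-filtered colimit factors through a single term of the diagram. -/
theorem exists_forall_factors {κ : Cardinal.{w}} [Fact κ.IsRegular] {J : Type w}
    [SmallCategory J] [IsCardinalFiltered J κ] {M : C} (p : ColimitPresentation J M)
    {W : Type*} (hW : HasCardinalLT W κ) (A : W → C) [∀ x, IsCardinalPresentable (A x) κ]
    (f : ∀ x, A x ⟶ M) :
    ∃ j, ∀ x, ∃ g : A x ⟶ p.diag.obj j, g ≫ p.ι.app j = f x := by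
  choose j g hg using fun x ↦
    IsCardinalPresentable.exists_hom_of_isColimit κ p.isColimit (f x)
  refine ⟨IsCardinalFiltered.max j hW, fun x ↦
    ⟨g x ≫ p.diag.map (IsCardinalFiltered.toMax j hW x), ?_⟩⟩
  rw [Category.assoc, p.w]
  exact hg x

/-- Let `P` be a generator of `μ`-presentable objects in a category of monomorphisms which is
`κ⁺`-accessible. If there is an object that is not `κ⁺`-presentable, then some
`κ⁺`-presentable object receives at least `κ` morphisms from objects in `P`. -/
theorem exists_isCardinalPresentable_succ_not_hasCardinalLT
    (hmono : ∀ {X Y : C} (f : X ⟶ Y), Mono f) {μ κ : Cardinal.{w}} [Fact μ.IsRegular]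
    [Fact (Order.succ κ).IsRegular] (hμκ : μ ≤ κ) [IsCardinalAccessibleCategory C (Order.succ κ)]
    {P : ObjectProperty C} (hP : P.IsCardinalFilteredGenerator μ)
    {M : C} (hM : ¬ IsCardinalPresentable M (Order.succ κ)) :
    ∃ N : C, IsCardinalPresentable N (Order.succ κ) ∧
      ¬ HasCardinalLT (Σ A : Subtype P, (A.1 ⟶ N)) κ := by
  have hA (A : Subtype P) : IsCardinalPresentable A.1 (Order.succ κ) :=
    isCardinalPresentable_monotone C (hμκ.trans (Order.le_succ κ)) _
      (hP.le_isCardinalPresentable _ A.2)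
  obtain ⟨R, _, hR⟩ := HasCardinalFilteredGenerator.exists_generator C (Order.succ κ)
  obtain ⟨J, _, _, ⟨p⟩⟩ := hR.exists_colimitsOfShape M
  have hp (j : J) : IsCardinalPresentable (p.diag.obj j) (Order.succ κ) :=
    hR.le_isCardinalPresentable _ (p.prop_diag_obj j)
  by_cases hh : HasCardinalLT (Σ A : Subtype P, (A.1 ⟶ M)) κ
  · exfalso
    obtain ⟨j, hj⟩ := exists_forall_factors p.toColimitPresentation
      (hh.of_le (Order.le_succ κ)) (fun x ↦ x.1.1) (fun x ↦ x.2)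
    obtain ⟨_, _, _, ⟨q⟩⟩ := hP.exists_colimitsOfShape M
    have := hmono (p.ι.app j)
    have : IsIso (p.ι.app j) := isIso_of_forall_factors q.toColimitPresentation _ fun k ↦
      hj ⟨⟨_, q.prop_diag_obj k⟩, q.ι.app k⟩
    exact hM (isCardinalPresentable_of_iso (asIso (p.ι.app j)) _)
  -- Lift `κ` distinct morphisms to one stage; the lifts stay distinct because composing with the
  -- leg recovers the originals.
  · obtain ⟨e⟩ : Nonempty (κ.out ↪ Σ A : Subtype P, (A.1 ⟶ M)) := by
      rw [← lift_mk_le', mk_out]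
      exact not_lt.1 hh
    obtain ⟨j, hj⟩ := exists_forall_factors p.toColimitPresentation
      (W := κ.out) (κ := Order.succ κ)
      (by simp [hasCardinalLT_iff_cardinal_mk_lt]) (fun x ↦ (e x).1.1) (fun x ↦ (e x).2)
    choose g hg using hj
    refine ⟨p.diag.obj j, hp j, fun hlt ↦ ?_⟩
    have := hlt.of_injective (fun x : κ.out ↦ (⟨(e x).1, g x⟩ :
        Σ A : Subtype P, (A.1 ⟶ p.diag.obj j))) fun x y hxy ↦ e.injective <| by
      have := congrArg (fun z : Σ A : Subtype P, (A.1 ⟶ p.diag.obj j) ↦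
        (⟨z.1, z.2 ≫ p.ι.app j⟩ : Σ A : Subtype P, (A.1 ⟶ M))) hxy
      dsimp only at this
      rwa [hg, hg] at this
    simp [hasCardinalLT_iff_cardinal_mk_lt] at this

end

/-- In a large well accessible category of monomorphisms, there are
objects of every large enough successor presentability rank, assuming ESCH. -/
theorem exists_hasPresentabilityRank_succ (hESCH : ESCH.{w}) (C : Type u) [Category.{v} C]
    (hmono : ∀ {X Y : C} (f : X ⟶ Y), Mono f) (hlarge : IsLarge.{w} C)
    (hwell : IsWellAccessible.{w} C) :
    ∃ κ₀ : Cardinal.{w}, ∀ κ : Cardinal.{w}, κ₀ ≤ κ →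
      ∃ X : C, HasPresentabilityRank X (Order.succ κ) := by
  obtain ⟨θ₀, hsch⟩ := hESCH
  obtain ⟨μ, hμ, hacc⟩ := hwell
  have : Fact μ.IsRegular := ⟨hμ⟩
  have := hacc μ le_rfl
  obtain ⟨P, _, hP⟩ := HasCardinalFilteredGenerator.exists_small_generator C μ
  obtain ⟨ν, hν⟩ := exists_hasCardinalLT_sigma_hom μ P hP
  have hne (κ : Cardinal.{w}) [Fact κ.IsRegular] (hκ : μ ≤ κ) :
      ∃ M : C, ¬ IsCardinalPresentable M κ := by
    by_contra! hall
    have := hacc κ hκ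
    refine hlarge ((essentiallySmall_iff_objectPropertyEssentiallySmall_top C).2 ?_)
    exact ObjectProperty.EssentiallySmall.of_le (Q := isCardinalPresentable C κ)
      fun X _ ↦ hall X
  let β := max μ (max ν (2 ^ max θ₀ μ))
  have hμβ : μ ≤ β := le_max_left _ _
  refine ⟨Order.succ β, fun κ hκ ↦ ?_⟩
  have hβκ : β < κ := Order.succ_le_iff.1 hκ
  have hμκ : μ ≤ κ := hμβ.trans hβκ.le
  have hω : Cardinal.aleph0 ≤ κ := hμ.aleph0_le.trans hμκ
  have hsucc : Fact (Order.succ κ).IsRegular := ⟨Cardinal.isRegular_succ hω⟩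
  by_cases hreg : κ.IsRegular
  · have : Fact κ.IsRegular := ⟨hreg⟩
    have := hacc κ hμκ
    obtain ⟨M, hM⟩ := hne κ hμκ
    obtain ⟨N, hN, hN'⟩ := exists_isCardinalPresentable_succ_of_isRegular hmono κ hM
    refine ⟨N, ⟨hsucc, hN⟩, ?_⟩
    rintro θ ⟨_, hθ⟩
    by_contra! hlt
    exact hN' (isCardinalPresentable_of_le N (Order.lt_succ_iff.1 hlt))
  · have := hacc (Order.succ κ) (hμκ.trans (Order.le_succ κ))
    obtain ⟨M, hM⟩ := hne (Order.succ κ) (hμκ.trans (Order.le_succ κ))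
    obtain ⟨N, hN, hN'⟩ :=
      exists_isCardinalPresentable_succ_not_hasCardinalLT hmono hμκ hP hM
    refine ⟨N, ⟨hsucc, hN⟩, ?_⟩
    rintro θ ⟨hθreg, hθ⟩
    by_contra! hlt
    have hθκ : θ < κ := lt_of_le_of_ne (Order.lt_succ_iff.1 hlt) fun h ↦ hreg (h ▸ hθreg.out)
    -- An infinite successor is regular, so the singular `κ` is a limit; this leaves room for `χ ≤
    -- α⁺ < κ`.
    have hsuccLT {x : Cardinal.{w}} (hx : Cardinal.aleph0 ≤ x) (hxκ : x < κ) :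
        Order.succ x < κ :=
      lt_of_le_of_ne (Order.succ_le_of_lt hxκ) fun h ↦ hreg (h ▸ Cardinal.isRegular_succ hx)
    let α := max θ β
    have hμα : μ ≤ α := hμβ.trans (le_max_right _ _)
    have hωα : Cardinal.aleph0 ≤ α := hμ.aleph0_le.trans hμα
    have hακ : α < κ := max_lt hθκ hβκ
    let χ := α ^ μ
    have hαχ : α ≤ χ := Cardinal.self_le_power α (Cardinal.one_le_aleph0.trans hμ.aleph0_le)
    have hχκ : χ < κ := (power_le_succ_of_schAt hμ.aleph0_le hsch α
      (((le_max_right _ _).trans (le_max_right _ _)).trans (le_max_right _ _))).trans_lt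
        (hsuccLT hωα hακ)
    have hχ : χ ^ μ = χ := by
      rw [← Cardinal.power_mul, Cardinal.mul_eq_self hμ.aleph0_le]
    have : Fact (Order.succ χ).IsRegular := ⟨Cardinal.isRegular_succ (hωα.trans hαχ)⟩
    have hνα : ν ≤ α := ((le_max_left _ _).trans (le_max_right _ _)).trans (le_max_right _ _)
    have hNχ : IsCardinalPresentable N (Order.succ χ) :=
      isCardinalPresentable_of_le N (((le_max_left θ β).trans hαχ).trans (Order.le_succ χ))
    exact hN' ((hν χ (hνα.trans hαχ) (hμα.trans hαχ) hχ N hNχ).of_le (Order.succ_le_of_lt hχκ))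

end LSAcc

theorem mainTheorem4 (hESCH : LSAcc.ESCH.{w})
    (C : Type u) [Category.{v} C]
    (hmono : ∀ {X Y : C} (f : X ⟶ Y), Mono f)
    (hlarge : LSAcc.IsLarge.{w} C)
    (hwell : LSAcc.IsWellAccessible.{w} C) :
    LSAcc.IsLSAccessible.{w} C ∧ LSAcc.HasAllLargeInternalSizes.{w} C := by
  obtain ⟨κ₀, h⟩ := LSAcc.exists_hasPresentabilityRank_succ hESCH C hmono hlarge hwell
  refine ⟨⟨?_, κ₀, h⟩, κ₀, fun κ hκ ↦ ?_⟩
  · obtain ⟨μ, hμ, hacc⟩ := hwell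
    have : Fact μ.IsRegular := ⟨hμ⟩
    exact ⟨μ, inferInstance, hacc μ le_rfl⟩
  · obtain ⟨X, hX⟩ := h κ hκ
    exact ⟨X, Or.inl hX⟩
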